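/- Let $(M,g)$ be a compact smooth Riemannian manifold, not necessarily connected and possibly with boundary $\partial M$. Let $dx$ be its volume measure, $|M|=\int_M 1\,dx$ its volume, and $\Delta_M=\operatorname{div}\operatorname{grad}$ its Laplace-Beltrami operator. The heat content of $M$ is $Q_M(t)=\int_M u(x;t)\,dx$, $t\ge 0$, where $u:M\times[0,\infty)\to\mathbb{R}$ is the unique solution, of class $C^2$ on $M\times(0,\infty)$, of $$\Delta_M u=\frac{\partial u}{\partial t}\quad(t>0),\qquad u(\cdot\,;0)=1,\qquad \lim_{t\downarrow 0}u(\cdot\,;t)=1\ \text{ in } L^2(M),\qquad u(x;t)=0\quad(x\in\partial M,\ t>0).$$ Two such manifolds $M_1$ and $M_2$ are called isoheat if $Q_{M_1}(t)=Q_{M_2}(t)$ for all $t>0$. Proposition. Let $M_1$ and $M_2$ be compact smooth Riemannian manifolds without boundary (not necessarily connected, and not necessarily of the same dimension) with the same volume, $|M_1|=|M_2|$. Then $M_1$ and $M_2$ are isoheat. Moreover, for $i=1,2$, the volume $|M_i|$ is finite, the heat problem above has exactly one solution on $M_i$, and $Q_{M_i}(t)=|M_i|$ for all $t\ge 0$.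 -/

import Mathlib

open scoped Manifold ContDiff Topology
open Set Filter MeasureTheory Bundle

noncomputable section

namespace HeatContent

variable {n : ℕ} {H : Type*} [TopologicalSpace H]
  {I : ModelWithCorners ℝ (EuclideanSpace ℝ (Fin n)) H}
  {M : Type*} [TopologicalSpace M] [ChartedSpace H M] [IsManifold I ∞ M]

variable (I M) in
/-- Smooth Riemannian metrics on the `n`-dimensional smooth manifold `M`
(possibly with boundary, according to the model `I`). -/
abbrev Metric : Type _ :=
  ContMDiffRiemannianMetric I ∞ (EuclideanSpace ℝ (Fin n)) (fun x : M => TangentSpace I x)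

variable (I) in
/-- The coordinate vector field `∂/∂yᵢ` of the chart around `x₀`, at the point whose coordinates
in this chart are `y`. -/
def coordVector (x₀ : M) (y : EuclideanSpace ℝ (Fin n)) (i : Fin n) :
    TangentSpace I ((extChartAt I x₀).symm y) :=
  mfderivWithin 𝓘(ℝ, EuclideanSpace ℝ (Fin n)) I (extChartAt I x₀).symm (range I) y
    (EuclideanSpace.single i (1 : ℝ))

/-- The matrix `(gᵢⱼ)` of the metric in the chart around `x₀`, as a function of the
coordinates `y`. -/
def gramMatrix (g : Metric I M) (x₀ : M) (y : EuclideanSpace ℝ (Fin n)) :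
    Matrix (Fin n) (Fin n) ℝ :=
  Matrix.of fun i j =>
    g.inner ((extChartAt I x₀).symm y) (coordVector I x₀ y i) (coordVector I x₀ y j)

/-- The Riemannian volume density `√(det (gᵢⱼ))` in the chart around `x₀`. -/
def density (g : Metric I M) (x₀ : M) (y : EuclideanSpace ℝ (Fin n)) : ℝ :=
  Real.sqrt (gramMatrix g x₀ y).det

/-- The Riemannian volume of the domain of the chart around `x₀`:
the measure `√(det (gᵢⱼ)) dy` on the range of the chart, transported to `M`. -/
def chartVolume [MeasurableSpace M] (g : Metric I M) (x₀ : M) : Measure M :=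
  Measure.map (extChartAt I x₀).symm
    ((volume.restrict (extChartAt I x₀).target).withDensity
      fun y => ENNReal.ofReal (density g x₀ y))

variable (I M) in
/-- A smooth partition of unity `(ρₓ)` subordinate to the cover of `M` by its charts. -/
def chartPartition [T2Space M] [SigmaCompactSpace M] : SmoothPartitionOfUnity M I M univ :=
  (SmoothPartitionOfUnity.exists_isSubordinate_chartAt_source I M).choose

/-- The Riemannian volume measure of `(M, g)`: the volumes in the charts, glued by means of a
partition of unity. -/
def riemannianVolume [T2Space M] [SigmaCompactSpace M] [MeasurableSpace M] (g : Metric I M) :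
    Measure M :=
  Measure.sum fun x₀ : M =>
    (chartVolume g x₀).withDensity fun x => ENNReal.ofReal (chartPartition I M x₀ x)

variable (I) in
/-- The partial derivative `∂h/∂yᵢ` in the model space (one-sided at the boundary). -/
def partialDeriv (i : Fin n) (h : EuclideanSpace ℝ (Fin n) → ℝ) (y : EuclideanSpace ℝ (Fin n)) :
    ℝ :=
  fderivWithin ℝ h (range I) y (EuclideanSpace.single i (1 : ℝ))

/-- The expression `(det g)^(-1/2) ∑ᵢⱼ ∂ᵢ ((det g)^(1/2) gⁱʲ ∂ⱼ f)` of the Laplace-Beltrami operator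
in the chart around `x₀`, at the point with coordinates `y`. -/
def chartLaplacian (g : Metric I M) (x₀ : M) (f : M → ℝ) (y : EuclideanSpace ℝ (Fin n)) : ℝ :=
  (density g x₀ y)⁻¹ * ∑ i, ∑ j, partialDeriv I i
    (fun z => density g x₀ z * (gramMatrix g x₀ z)⁻¹ i j *
      partialDeriv I j (fun w => f ((extChartAt I x₀).symm w)) z) y

/-- The Laplace-Beltrami operator `Δ_M` (the divergence of the gradient, a nonpositive operator),
computed at `x` in the chart around `x`. -/
def laplacian (g : Metric I M) (f : M → ℝ) (x : M) : ℝ :=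
  chartLaplacian g x f (extChartAt I x x)

section Heat

variable [T2Space M] [SigmaCompactSpace M] [MeasurableSpace M]

/-- `u` solves the heat equation on `(M, g)` with initial datum `1` and Dirichlet boundary
conditions. Only the values `u x t` with `t ≥ 0` matter. -/
structure IsHeatSolution (g : Metric I M) (u : M → ℝ → ℝ) : Prop where
  /-- `u` is of class `C²` on `M × (0, ∞)` (up to the boundary of `M`). -/
  regular : ContMDiffOn (I.prod 𝓘(ℝ, ℝ)) 𝓘(ℝ, ℝ) 2 (fun p : M × ℝ => u p.1 p.2) (univ ×ˢ Ioi 0)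
  /-- The heat equation `∂u/∂t = Δ_M u`. -/
  heat_eq : ∀ x, ∀ t > 0, HasDerivAt (fun s => u x s) (laplacian g (fun z => u z t) x) t
  /-- The value at time `0`. -/
  initial : ∀ x, u x 0 = 1
  /-- The initial value is attained in `L²(M)`. -/
  tendsto_initial :
    Tendsto (fun t => eLpNorm (fun x => u x t - 1) 2 (riemannianVolume g)) (𝓝[>] 0) (𝓝 0)
  /-- The Dirichlet boundary condition. -/
  dirichlet : ∀ x ∈ I.boundary M, ∀ t > 0, u x t = 0

/-- The heat problem on `(M, g)` has a solution, and only one, on `M × [0, ∞)`. -/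
def HasUniqueHeatSolution (g : Metric I M) : Prop :=
  ∃ u, IsHeatSolution g u ∧ ∀ v, IsHeatSolution g v → ∀ x, ∀ t ≥ 0, v x t = u x t

/-- The solution of the heat problem on `(M, g)` (some function, if there is none). -/
def heatSolution (g : Metric I M) : M → ℝ → ℝ :=
  Classical.epsilon (IsHeatSolution g)

/-- The heat content `Q_M(t)` of `(M, g)`. -/
def heatContent (g : Metric I M) (t : ℝ) : ℝ :=
  ∫ x, heatSolution g x t ∂(riemannianVolume g)

end Heat

/-- Two Riemannian manifolds are isoheat if they have the same heat content at all times `t > 0`. -/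
def Isoheat
    {n₁ : ℕ} {H₁ : Type*} [TopologicalSpace H₁]
    {I₁ : ModelWithCorners ℝ (EuclideanSpace ℝ (Fin n₁)) H₁}
    {M₁ : Type*} [TopologicalSpace M₁] [ChartedSpace H₁ M₁] [IsManifold I₁ ∞ M₁]
    [T2Space M₁] [SigmaCompactSpace M₁] [MeasurableSpace M₁]
    {n₂ : ℕ} {H₂ : Type*} [TopologicalSpace H₂]
    {I₂ : ModelWithCorners ℝ (EuclideanSpace ℝ (Fin n₂)) H₂}
    {M₂ : Type*} [TopologicalSpace M₂] [ChartedSpace H₂ M₂] [IsManifold I₂ ∞ M₂]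
    [T2Space M₂] [SigmaCompactSpace M₂] [MeasurableSpace M₂]
    (g₁ : Metric I₁ M₁) (g₂ : Metric I₂ M₂) : Prop :=
  ∀ t > 0, heatContent g₁ t = heatContent g₂ t

end HeatContent

end

/-! Without boundary the constant `1` solves the heat problem, so everything rests on uniqueness.
For a solution `v` put `E(t) = ∫ (v - 1)²`. Green's formula gives `E' = 2 ∫ (v - 1) Δv = -2 ∫ |∇v|²
≤ 0`, and `E(t) → 0` as `t ↓ 0`. Hence `E = 0`, and `v = 1` by continuity, since nonempty open sets
have positive volume (`IsHeatSolution.eq_one`). The heat content is therefore the volume, which is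
finite by compactness.

Most of the work goes into Green's formula, `integral_mul_laplacian`, because volume and Laplacian
are given in charts. By change of variables, the glued volume agrees on each chart domain with the
volume of that chart (`riemannianVolume_apply_eq_chartVolume`); integration by parts in the chart
then gives Green's formula for functions supported there. The Laplacian at `x` uses the chart around
`x`, so its independence of the chart is needed. Second derivatives are never transformed for this:
tested against functions supported in both charts, the two expressions reduce to the first-order
`gradInner`, whose invariance is linear algebra (`chartLaplacian_eq_of_mem`). A partition of unity
globalises the formula. -/

noncomputable section

namespace HeatContent

variable {n : ℕ} {M : Type*} [TopologicalSpace M] [ChartedSpace (EuclideanSpace ℝ (Fin n)) M]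

/-! ### Changes of coordinates and their Jacobians. -/

section Coordinates

/-- The change of coordinates from the chart around `b` to the chart around `a`. -/
def transition (a b : M) (y : EuclideanSpace ℝ (Fin n)) : EuclideanSpace ℝ (Fin n) :=
  extChartAt (𝓡 n) a ((extChartAt (𝓡 n) b).symm y)

/-- The coordinates in the chart around `b` of the points of `U`. -/
def coordPreimage (b : M) (U : Set M) : Set (EuclideanSpace ℝ (Fin n)) :=
  (extChartAt (𝓡 n) b).target ∩ (extChartAt (𝓡 n) b).symm ⁻¹' U

theorem isOpen_target (a : M) : IsOpen (extChartAt (𝓡 n) a).target :=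
  isOpen_extChartAt_target a

theorem isOpen_coordPreimage (b : M) {U : Set M} (hU : IsOpen U) :
    IsOpen (coordPreimage (n := n) b U) :=
  (continuousOn_extChartAt_symm b).isOpen_inter_preimage (isOpen_target b) hU

/-- The Jacobian matrix of a map, in the standard coordinates. -/
def jacobian (τ : EuclideanSpace ℝ (Fin n) → EuclideanSpace ℝ (Fin n))
    (y : EuclideanSpace ℝ (Fin n)) : Matrix (Fin n) (Fin n) ℝ :=
  Matrix.of fun k i => fderiv ℝ τ y (EuclideanSpace.single i 1) k

theorem sum_smul_single (v : EuclideanSpace ℝ (Fin n)) :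
    v = ∑ k, v k • EuclideanSpace.single k (1 : ℝ) := by
  ext j
  simp [Pi.single_apply]

theorem map_eq_sum_single {F : Type*} [NormedAddCommGroup F] [NormedSpace ℝ F]
    (L : EuclideanSpace ℝ (Fin n) →L[ℝ] F) (v : EuclideanSpace ℝ (Fin n)) :
    L v = ∑ k, v k • L (EuclideanSpace.single k (1 : ℝ)) := by
  conv_lhs => rw [sum_smul_single v, map_sum]
  simp

theorem det_jacobian (τ : EuclideanSpace ℝ (Fin n) → EuclideanSpace ℝ (Fin n))
    (y : EuclideanSpace ℝ (Fin n)) : (jacobian τ y).det = (fderiv ℝ τ y).det := by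
  rw [ContinuousLinearMap.det, ← LinearMap.det_toMatrix (EuclideanSpace.basisFun (Fin n) ℝ).toBasis]
  congr 1

theorem partialDeriv_eq (i : Fin n) (h : EuclideanSpace ℝ (Fin n) → ℝ)
    (y : EuclideanSpace ℝ (Fin n)) :
    partialDeriv (𝓡 n) i h y = fderiv ℝ h y (EuclideanSpace.single i 1) := by
  simp [partialDeriv]

theorem partialDeriv_comp {τ : EuclideanSpace ℝ (Fin n) → EuclideanSpace ℝ (Fin n)}
    {h : EuclideanSpace ℝ (Fin n) → ℝ} {y : EuclideanSpace ℝ (Fin n)} (hτ : DifferentiableAt ℝ τ y)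
    (hh : DifferentiableAt ℝ h (τ y)) (i : Fin n) :
    partialDeriv (𝓡 n) i (fun z => h (τ z)) y =
      ∑ k, jacobian τ y k i * partialDeriv (𝓡 n) k h (τ y) := by
  simp only [partialDeriv_eq]
  rw [show (fun z => h (τ z)) = h ∘ τ from rfl, fderiv_comp y hh hτ, ContinuousLinearMap.comp_apply,
    map_eq_sum_single]
  simp [jacobian]

theorem symm_transition {a b : M} {y : EuclideanSpace ℝ (Fin n)}
    (hy : y ∈ coordPreimage b (extChartAt (𝓡 n) a).source) :
    (extChartAt (𝓡 n) a).symm (transition a b y) = (extChartAt (𝓡 n) b).symm y :=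
  (extChartAt (𝓡 n) a).left_inv hy.2

theorem transition_mem {a b : M} {y : EuclideanSpace ℝ (Fin n)}
    (hy : y ∈ coordPreimage b (extChartAt (𝓡 n) a).source) :
    transition a b y ∈ coordPreimage a (extChartAt (𝓡 n) b).source := by
  refine ⟨(extChartAt (𝓡 n) a).map_source hy.2, ?_⟩
  rw [mem_preimage, symm_transition hy]
  exact (extChartAt (𝓡 n) b).map_target hy.1

theorem transition_transition {a b : M} {y : EuclideanSpace ℝ (Fin n)}
    (hy : y ∈ coordPreimage b (extChartAt (𝓡 n) a).source) :
    transition b a (transition a b y) = y := by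
  rw [transition, symm_transition hy]
  exact (extChartAt (𝓡 n) b).right_inv hy.1

theorem coordVector_eq_mfderiv (b : M) (y : EuclideanSpace ℝ (Fin n)) (i : Fin n) :
    coordVector (𝓡 n) b y i = mfderiv 𝓘(ℝ, EuclideanSpace ℝ (Fin n)) (𝓡 n)
      (extChartAt (𝓡 n) b).symm y (EuclideanSpace.single i (1 : ℝ)) := by
  simp [coordVector, mfderivWithin_univ]

variable [IsManifold (𝓡 n) ∞ M]

theorem transition_contDiffAt {a b : M} {y : EuclideanSpace ℝ (Fin n)}
    (hy : y ∈ coordPreimage b (extChartAt (𝓡 n) a).source) :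
    ContDiffAt ℝ ∞ (transition a b) y := by
  have h1 : ContMDiffAt 𝓘(ℝ, EuclideanSpace ℝ (Fin n)) (𝓡 n) ∞ (extChartAt (𝓡 n) b).symm y :=
    (contMDiffOn_extChartAt_symm b).contMDiffAt ((isOpen_target b).mem_nhds hy.1)
  have h2 : ContMDiffAt (𝓡 n) 𝓘(ℝ, EuclideanSpace ℝ (Fin n)) ∞ (extChartAt (𝓡 n) a)
      ((extChartAt (𝓡 n) b).symm y) := by
    apply contMDiffAt_extChartAt'
    have := hy.2
    simpa using this
  exact (h2.comp y h1).contDiffAt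

/-- Chain rule for the inverse chart at `b`, which near `y` is the inverse chart at `a` composed
with `transition a b`. -/
theorem coordVector_transition {a b : M} {y : EuclideanSpace ℝ (Fin n)}
    (hy : y ∈ coordPreimage b (extChartAt (𝓡 n) a).source) (i : Fin n) :
    (coordVector (𝓡 n) b y i : EuclideanSpace ℝ (Fin n)) =
      ∑ k, jacobian (transition a b) y k i •
        (coordVector (𝓡 n) a (transition a b y) k : EuclideanSpace ℝ (Fin n)) := by
  simp only [coordVector_eq_mfderiv]
  have h1 : MDifferentiableAt 𝓘(ℝ, EuclideanSpace ℝ (Fin n)) (𝓡 n) (extChartAt (𝓡 n) a).symm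
      (transition a b y) :=
    ((contMDiffOn_extChartAt_symm a).contMDiffAt
      ((isOpen_target a).mem_nhds (transition_mem hy).1)).mdifferentiableAt (n := ∞) (by simp)
  have h2 : MDifferentiableAt 𝓘(ℝ, EuclideanSpace ℝ (Fin n)) 𝓘(ℝ, EuclideanSpace ℝ (Fin n))
      (transition a b) y :=
    ((transition_contDiffAt hy).differentiableAt (by simp)).mdifferentiableAt
  have h3 : (extChartAt (𝓡 n) b).symm =ᶠ[𝓝 y] (extChartAt (𝓡 n) a).symm ∘ transition a b := by
    filter_upwards [(isOpen_coordPreimage b (isOpen_extChartAt_source (I := 𝓡 n) a)).mem_nhds hy]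
      with z hz
    exact (symm_transition hz).symm
  have h4 := h3.mfderiv_eq (I := 𝓘(ℝ, EuclideanSpace ℝ (Fin n))) (I' := 𝓡 n)
  have h5 := mfderiv_comp y h1 h2
  -- Every tangent space is the model space by definition; the chain rule is restated there, where
  -- the base points no longer enter the types.
  have h6 : ∀ v : EuclideanSpace ℝ (Fin n),
      (mfderiv 𝓘(ℝ, EuclideanSpace ℝ (Fin n)) (𝓡 n) (extChartAt (𝓡 n) b).symm y v :
        EuclideanSpace ℝ (Fin n)) =
      (mfderiv 𝓘(ℝ, EuclideanSpace ℝ (Fin n)) (𝓡 n) (extChartAt (𝓡 n) a).symm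
        (transition a b y) : EuclideanSpace ℝ (Fin n) →L[ℝ] EuclideanSpace ℝ (Fin n))
          (fderiv ℝ (transition a b) y v) := by
    intro v
    have := congrArg (fun (L : EuclideanSpace ℝ (Fin n) →L[ℝ] EuclideanSpace ℝ (Fin n)) => L v)
      (h4.trans h5)
    rw [mfderiv_eq_fderiv] at this
    exact this
  rw [h6]
  exact map_eq_sum_single (F := EuclideanSpace ℝ (Fin n)) _ _

end Coordinates

/-! ### Gram matrix and volume density: transformation, positivity, smoothness. -/

section Metric

theorem bilinear_sum_smul {F ι : Type*} [NormedAddCommGroup F] [NormedSpace ℝ F] [Fintype ι]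
    (B : F →L[ℝ] F →L[ℝ] ℝ) (c d : ι → ℝ) (v : ι → F) :
    B (∑ k, c k • v k) (∑ l, d l • v l) = ∑ k, ∑ l, c k * d l * B (v k) (v l) := by
  simp only [map_sum, map_smul, sum_apply, smul_apply, smul_eq_mul, Finset.mul_sum]
  rw [Finset.sum_comm]
  refine Finset.sum_congr rfl fun k _ => Finset.sum_congr rfl fun l _ => ?_
  ring

variable [IsManifold (𝓡 n) ∞ M]

/-- The metric at a point, as a bilinear form on the model space. -/
def metricForm (g : Metric (𝓡 n) M) (x : M) :
    EuclideanSpace ℝ (Fin n) →L[ℝ] EuclideanSpace ℝ (Fin n) →L[ℝ] ℝ :=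
  g.inner x

theorem gramMatrix_apply (g : Metric (𝓡 n) M) (a : M) (y : EuclideanSpace ℝ (Fin n))
    (i j : Fin n) : gramMatrix g a y i j =
      metricForm g ((extChartAt (𝓡 n) a).symm y) (coordVector (𝓡 n) a y i)
        (coordVector (𝓡 n) a y j) := rfl

theorem gramMatrix_transition (g : Metric (𝓡 n) M) {a b : M} {y : EuclideanSpace ℝ (Fin n)}
    (hy : y ∈ coordPreimage b (extChartAt (𝓡 n) a).source) :
    gramMatrix g b y = (jacobian (transition a b) y).transpose *
      gramMatrix g a (transition a b y) * jacobian (transition a b) y := by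
  ext i j
  rw [gramMatrix_apply, coordVector_transition hy i, coordVector_transition hy j,
    ← symm_transition hy]
  refine (bilinear_sum_smul (metricForm g _) _ _
    (fun k => (coordVector (𝓡 n) a (transition a b y) k : EuclideanSpace ℝ (Fin n)))).trans ?_
  simp only [Matrix.mul_apply, Matrix.transpose_apply, Finset.sum_mul]
  rw [Finset.sum_comm]
  refine Finset.sum_congr rfl fun k _ => Finset.sum_congr rfl fun l _ => ?_
  rw [gramMatrix_apply]
  ring

/-- Determinants in `G_b = Jᵀ G_a J` give `det G_b = (det J)² det G_a`; the square root produces the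
factor of the change of variables formula. -/
theorem density_transition (g : Metric (𝓡 n) M) {a b : M} {y : EuclideanSpace ℝ (Fin n)}
    (hy : y ∈ coordPreimage b (extChartAt (𝓡 n) a).source) :
    density g b y = |(fderiv ℝ (transition a b) y).det| * density g a (transition a b y) := by
  rw [density, density, gramMatrix_transition g hy, Matrix.det_mul, Matrix.det_mul,
    Matrix.det_transpose, det_jacobian, ← Real.sqrt_sq_eq_abs, ← Real.sqrt_mul (sq_nonneg _)]
  congr 1
  ring

/-- The coordinate vectors are the images of the standard basis under the derivative of the inverse
chart, which is invertible. -/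
theorem coordVector_sum_eq_zero {a : M} {y : EuclideanSpace ℝ (Fin n)}
    (hy : y ∈ (extChartAt (𝓡 n) a).target) (c : Fin n → ℝ)
    (h : ∑ i, c i • (coordVector (𝓡 n) a y i : EuclideanSpace ℝ (Fin n)) = 0) : c = 0 := by
  have hinv := isInvertible_mfderivWithin_extChartAt_symm (I := 𝓡 n) hy
  have h1 : (mfderivWithin 𝓘(ℝ, EuclideanSpace ℝ (Fin n)) (𝓡 n) (extChartAt (𝓡 n) a).symm
      (range (𝓡 n)) y : EuclideanSpace ℝ (Fin n) →L[ℝ] EuclideanSpace ℝ (Fin n))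
        (WithLp.toLp 2 c) = 0 :=
    (map_eq_sum_single (F := EuclideanSpace ℝ (Fin n)) _ _).trans h
  have h2 := hinv.injective (h1.trans (map_zero _).symm)
  ext i
  exact congrArg (fun v : EuclideanSpace ℝ (Fin n) => v i) h2

theorem gramMatrix_posDef (g : Metric (𝓡 n) M) {a : M} {y : EuclideanSpace ℝ (Fin n)}
    (hy : y ∈ (extChartAt (𝓡 n) a).target) : (gramMatrix g a y).PosDef := by
  refine Matrix.PosDef.of_dotProduct_mulVec_pos ?_ fun c hc => ?_
  · ext i j
    simp only [Matrix.conjTranspose_apply, gramMatrix_apply, star_trivial]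
    exact g.symm _ _ _
  · have h0 : ∑ i, c i • (coordVector (𝓡 n) a y i : EuclideanSpace ℝ (Fin n)) ≠ 0 :=
      fun h => hc (coordVector_sum_eq_zero hy c h)
    have h1 := g.pos _ _ h0
    change 0 < metricForm g ((extChartAt (𝓡 n) a).symm y) _ _ at h1
    refine h1.trans_eq ((bilinear_sum_smul (metricForm g _) _ _
      (fun k => (coordVector (𝓡 n) a y k : EuclideanSpace ℝ (Fin n)))).trans ?_)
    simp only [dotProduct, Matrix.mulVec, gramMatrix_apply, Pi.star_apply, star_trivial,
      Finset.mul_sum]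
    refine Finset.sum_congr rfl fun k _ => Finset.sum_congr rfl fun l _ => ?_
    ring

theorem density_pos (g : Metric (𝓡 n) M) {a : M} {y : EuclideanSpace ℝ (Fin n)}
    (hy : y ∈ (extChartAt (𝓡 n) a).target) : 0 < density g a y :=
  Real.sqrt_pos.2 (gramMatrix_posDef g hy).det_pos

/-- The coordinate field is the tangent map of the inverse chart applied to a constant vector field.
-/
theorem coordVector_contMDiffOn (a : M) (i : Fin n) :
    ContMDiffOn 𝓘(ℝ, EuclideanSpace ℝ (Fin n)) (𝓡 n).tangent ∞
      (fun y => (⟨(extChartAt (𝓡 n) a).symm y, coordVector (𝓡 n) a y i⟩ : TangentBundle (𝓡 n) M))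
      (extChartAt (𝓡 n) a).target := by
  have h1 := (contMDiffOn_extChartAt_symm (n := ∞) (I := 𝓡 n) a).contMDiffOn_tangentMapWithin
    (m := ∞) (by simp) (isOpen_target a).uniqueMDiffOn
  have h2 : ContMDiffOn 𝓘(ℝ, EuclideanSpace ℝ (Fin n)) 𝓘(ℝ, EuclideanSpace ℝ (Fin n)).tangent ∞
      (fun y => (⟨y, EuclideanSpace.single i (1 : ℝ)⟩ :
        TangentBundle 𝓘(ℝ, EuclideanSpace ℝ (Fin n)) (EuclideanSpace ℝ (Fin n))))
      (extChartAt (𝓡 n) a).target :=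
    contMDiffOn_vectorSpace_iff_contDiffOn.2 contDiffOn_const
  refine (h1.comp h2 fun y hy => hy).congr fun y hy => ?_
  simp only [Function.comp, tangentMapWithin]
  rw [coordVector_eq_mfderiv, mfderivWithin_of_isOpen (isOpen_target a) hy]

theorem gramMatrix_contDiffOn (g : Metric (𝓡 n) M) (a : M) (i j : Fin n) :
    ContDiffOn ℝ ∞ (fun y => gramMatrix g a y i j) (extChartAt (𝓡 n) a).target := by
  have h1 := g.contMDiff.comp_contMDiffOn (contMDiffOn_extChartAt_symm (n := ∞) (I := 𝓡 n) a)
  have h2 := ContMDiffOn.clm_bundle_apply₂ (F₃ := ℝ) (E₃ := Bundle.Trivial M ℝ) h1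
    (coordVector_contMDiffOn a i) (coordVector_contMDiffOn a j)
  intro y hy
  have h3 := h2 y hy
  rw [contMDiffWithinAt_totalSpace] at h3
  exact h3.2.contDiffWithinAt

theorem gramMatrix_det_contDiffOn (g : Metric (𝓡 n) M) (a : M) :
    ContDiffOn ℝ ∞ (fun y => (gramMatrix g a y).det) (extChartAt (𝓡 n) a).target := by
  simp only [Matrix.det_apply]
  refine ContDiffOn.sum fun σ _ => ContDiffOn.const_smul _ ?_
  exact contDiffOn_prod fun i _ => gramMatrix_contDiffOn g a _ _

theorem density_contDiffOn (g : Metric (𝓡 n) M) (a : M) :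
    ContDiffOn ℝ ∞ (density g a) (extChartAt (𝓡 n) a).target :=
  (gramMatrix_det_contDiffOn g a).sqrt fun _ hy => (gramMatrix_posDef g hy).det_pos.ne'

theorem gramMatrix_inv_contDiffOn (g : Metric (𝓡 n) M) (a : M) (i j : Fin n) :
    ContDiffOn ℝ ∞ (fun y => (gramMatrix g a y)⁻¹ i j) (extChartAt (𝓡 n) a).target := by
  -- Cramer's rule: each entry is the inverse determinant times a polynomial in the entries of the
  -- Gram matrix.
  simp only [Matrix.inv_def, Matrix.smul_apply, smul_eq_mul, Ring.inverse_eq_inv',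
    Matrix.adjugate_apply, Matrix.det_apply]
  refine ContDiffOn.mul ?_ (ContDiffOn.sum fun σ _ => ContDiffOn.const_smul _ ?_)
  · simp only [← Matrix.det_apply]
    exact (gramMatrix_det_contDiffOn g a).inv fun _ hy => (gramMatrix_posDef g hy).det_pos.ne'
  · refine contDiffOn_prod fun k _ => ?_
    simp only [Matrix.updateRow_apply]
    split_ifs
    · exact contDiffOn_const
    · exact gramMatrix_contDiffOn g a _ _

end Metric

/-! ### The Riemannian volume measure. -/

section Volume

theorem coordPreimage_eq_image_transition {a b : M} {A : Set M}
    (hA : A ⊆ (extChartAt (𝓡 n) a).source ∩ (extChartAt (𝓡 n) b).source) :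
    coordPreimage (n := n) a A = transition a b '' coordPreimage b A := by
  ext y
  constructor
  · intro hy
    have hy' : y ∈ coordPreimage a (extChartAt (𝓡 n) b).source := ⟨hy.1, (hA hy.2).2⟩
    refine ⟨transition b a y, ⟨(transition_mem hy').1, ?_⟩, transition_transition hy'⟩
    rw [mem_preimage, symm_transition hy']
    exact hy.2
  · rintro ⟨z, hz, rfl⟩
    have hz' : z ∈ coordPreimage b (extChartAt (𝓡 n) a).source := ⟨hz.1, (hA hz.2).1⟩
    refine ⟨(transition_mem hz').1, ?_⟩
    rw [mem_preimage, symm_transition hz']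
    exact hz.2

theorem transition_injOn {a b : M} :
    InjOn (transition a b) (coordPreimage (n := n) b (extChartAt (𝓡 n) a).source) :=
  fun y hy z hz h => by
    rw [← transition_transition hy, h, transition_transition hz]

theorem aemeasurable_symm [MeasurableSpace M] [BorelSpace M] (a : M) :
    AEMeasurable (extChartAt (𝓡 n) a).symm
      (volume.restrict (extChartAt (𝓡 n) a).target) :=
  (continuousOn_extChartAt_symm a).aemeasurable (isOpen_target a).measurableSet

theorem measurableSet_coordPreimage [MeasurableSpace M] [BorelSpace M] (a : M) {A : Set M}
    (hA : MeasurableSet A) : MeasurableSet (coordPreimage (n := n) a A) := by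
  have h1 : Measurable ((extChartAt (𝓡 n) a).target.domRestrict (extChartAt (𝓡 n) a).symm) :=
    (continuousOn_extChartAt_symm a).domRestrict.measurable
  have h2 := (MeasurableEmbedding.subtype_coe (isOpen_target a).measurableSet).measurableSet_image.2
    (h1 hA)
  convert h2 using 1
  ext y
  simp only [coordPreimage, mem_inter_iff, mem_preimage, mem_image, Subtype.exists]
  constructor
  · rintro ⟨h, h'⟩
    exact ⟨y, h, h', rfl⟩
  · rintro ⟨z, h, h', rfl⟩
    exact ⟨h, h'⟩

section Partition

variable [IsManifold (𝓡 n) ∞ M] [T2Space M] [CompactSpace M]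

theorem chartPartition_isSubordinate :
    (chartPartition (𝓡 n) M).IsSubordinate fun x => (chartAt (EuclideanSpace ℝ (Fin n)) x).source :=
  (SmoothPartitionOfUnity.exists_isSubordinate_chartAt_source (𝓡 n) M).choose_spec

theorem chartPartition_tsupport (b : M) :
    tsupport (chartPartition (𝓡 n) M b) ⊆ (extChartAt (𝓡 n) b).source := by
  rw [extChartAt_source]
  exact chartPartition_isSubordinate b

-- A locally finite family on a compact space has only finitely many nonzero members, so sums over
-- all points of `M` become finite.
variable (n M) in
theorem chartPartition_finite :
    {b : M | (Function.support (chartPartition (𝓡 n) M b)).Nonempty}.Finite :=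
  (chartPartition (𝓡 n) M).locallyFinite.finite_nonempty_of_compact

variable (n M) in
/-- The finitely many charts that enter the partition of unity. -/
def chartIndices : Finset M := (chartPartition_finite n M).toFinset

theorem chartPartition_eq_zero {b : M} (hb : b ∉ chartIndices n M) (x : M) :
    chartPartition (𝓡 n) M b x = 0 := by
  by_contra h
  exact hb ((chartPartition_finite n M).mem_toFinset.2 ⟨x, h⟩)

theorem sum_chartPartition (x : M) : ∑ b ∈ chartIndices n M, chartPartition (𝓡 n) M b x = 1 := by
  rw [← (chartPartition (𝓡 n) M).sum_eq_one (mem_univ x), finsum_eq_sum_of_support_subset]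
  intro b hb
  by_contra h
  exact hb (chartPartition_eq_zero h x)

end Partition

variable [IsManifold (𝓡 n) ∞ M] [MeasurableSpace M] [BorelSpace M]

theorem chartVolume_apply (g : Metric (𝓡 n) M) (a : M) {A : Set M} (hA : MeasurableSet A) :
    chartVolume g a A = ∫⁻ y in coordPreimage a A, ENNReal.ofReal (density g a y) := by
  rw [chartVolume, Measure.map_apply_of_aemeasurable
    ((aemeasurable_symm a).mono_ac (withDensity_absolutelyContinuous _ _)) hA]
  have h1 : NullMeasurableSet ((extChartAt (𝓡 n) a).symm ⁻¹' A)
      (volume.restrict (extChartAt (𝓡 n) a).target) :=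
    (aemeasurable_symm a).nullMeasurable hA
  rw [withDensity_apply₀ _ h1, Measure.restrict_restrict₀ h1, inter_comm]
  rfl

theorem chartVolume_apply_eq (g : Metric (𝓡 n) M) {a b : M} {A : Set M} (hA : MeasurableSet A)
    (hab : A ⊆ (extChartAt (𝓡 n) a).source ∩ (extChartAt (𝓡 n) b).source) :
    chartVolume g a A = chartVolume g b A := by
  have hsub : coordPreimage (n := n) b A ⊆ coordPreimage b (extChartAt (𝓡 n) a).source :=
    fun y hy => ⟨hy.1, (hab hy.2).1⟩
  rw [chartVolume_apply g a hA, chartVolume_apply g b hA, coordPreimage_eq_image_transition hab,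
    lintegral_image_eq_lintegral_abs_det_fderiv_mul volume (measurableSet_coordPreimage b hA)
      (f' := fderiv ℝ (transition a b))
      (fun y hy => ((transition_contDiffAt (hsub hy)).differentiableAt
        (by simp)).hasFDerivAt.hasFDerivWithinAt) (transition_injOn.mono hsub)]
  refine setLIntegral_congr_fun (measurableSet_coordPreimage b hA) fun y hy => ?_
  rw [density_transition g (hsub hy), ENNReal.ofReal_mul (abs_nonneg _)]

theorem chartVolume_restrict_eq (g : Metric (𝓡 n) M) (a b : M) :
    (chartVolume g a).restrict ((extChartAt (𝓡 n) a).source ∩ (extChartAt (𝓡 n) b).source) =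
      (chartVolume g b).restrict
        ((extChartAt (𝓡 n) a).source ∩ (extChartAt (𝓡 n) b).source) := by
  ext A hA
  have hm : MeasurableSet ((extChartAt (𝓡 n) a).source ∩ (extChartAt (𝓡 n) b).source) :=
    ((isOpen_extChartAt_source a).inter (isOpen_extChartAt_source b)).measurableSet
  rw [Measure.restrict_apply hA, Measure.restrict_apply hA]
  exact chartVolume_apply_eq g (hA.inter hm) inter_subset_right

theorem chartVolume_restrict_source (g : Metric (𝓡 n) M) (a : M) :
    (chartVolume g a).restrict (extChartAt (𝓡 n) a).source = chartVolume g a := by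
  refine Measure.restrict_eq_self_of_ae_mem ?_
  rw [ae_iff]
  change chartVolume g a (extChartAt (𝓡 n) a).sourceᶜ = 0
  rw [chartVolume_apply g a (isOpen_extChartAt_source a).measurableSet.compl]
  have : coordPreimage (n := n) a (extChartAt (𝓡 n) a).sourceᶜ = ∅ := by
    ext y
    simp only [coordPreimage, mem_inter_iff, mem_preimage, mem_compl_iff, mem_empty_iff_false,
      iff_false, not_and, not_not]
    exact fun h => (extChartAt (𝓡 n) a).map_target h
  rw [this]
  simp

variable [T2Space M] [CompactSpace M]

/-- Inside the chart at `a`, each summand of the glued measure may be computed with the volume of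
that chart; the weights then add up to `1`. -/
theorem riemannianVolume_apply_eq_chartVolume (g : Metric (𝓡 n) M) {a : M} {A : Set M}
    (hA : MeasurableSet A) (ha : A ⊆ (extChartAt (𝓡 n) a).source) :
    riemannianVolume g A = chartVolume g a A := by
  have hmeas : ∀ b : M, Measurable fun x => ENNReal.ofReal (chartPartition (𝓡 n) M b x) :=
    fun b => ((chartPartition (𝓡 n) M b).contMDiff.continuous.measurable).ennreal_ofReal
  have key : ∀ b, ∫⁻ x in A, ENNReal.ofReal (chartPartition (𝓡 n) M b x) ∂chartVolume g b =
      ∫⁻ x in A, ENNReal.ofReal (chartPartition (𝓡 n) M b x) ∂chartVolume g a := by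
    intro b
    have hb : MeasurableSet (extChartAt (𝓡 n) b).source :=
      (isOpen_extChartAt_source b).measurableSet
    -- On `A` the weight of `b` lives on the overlap of the two chart domains, where the two chart
    -- volumes agree.
    have h0 : ∀ ν : Measure M, ∫⁻ x in A, ENNReal.ofReal (chartPartition (𝓡 n) M b x) ∂ν =
        ∫⁻ x in A, ENNReal.ofReal (chartPartition (𝓡 n) M b x)
          ∂(ν.restrict ((extChartAt (𝓡 n) a).source ∩ (extChartAt (𝓡 n) b).source)) := by
      intro ν
      rw [Measure.restrict_restrict hA, ← inter_assoc, inter_eq_left.2 ha,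
        ← Measure.restrict_restrict hA, ← lintegral_indicator hA, ← lintegral_indicator hA]
      symm
      apply setLIntegral_eq_of_support_subset
      intro x hx
      by_contra h
      apply hx
      have hb0 : chartPartition (𝓡 n) M b x = 0 :=
        image_eq_zero_of_notMem_tsupport fun h' => h (chartPartition_tsupport b h')
      by_cases hx' : x ∈ A <;> simp [hx', hb0]
    rw [h0, h0 (chartVolume g a), chartVolume_restrict_eq]
  rw [riemannianVolume, Measure.sum_apply _ hA]
  simp only [withDensity_apply _ hA, key]
  rw [tsum_eq_sum (s := chartIndices n M), ← lintegral_finsetSum _ fun b _ => hmeas b]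
  · simp only [← ENNReal.ofReal_sum_of_nonneg fun b _ => (chartPartition (𝓡 n) M).nonneg b _,
      sum_chartPartition]
    simp
  · intro b hb
    simp [chartPartition_eq_zero hb]

theorem riemannianVolume_restrict (g : Metric (𝓡 n) M) (a : M) :
    (riemannianVolume g).restrict (extChartAt (𝓡 n) a).source = chartVolume g a := by
  rw [← chartVolume_restrict_source]
  ext A hA
  rw [Measure.restrict_apply hA, Measure.restrict_apply hA]
  exact riemannianVolume_apply_eq_chartVolume g
    (hA.inter (isOpen_extChartAt_source a).measurableSet) inter_subset_right

theorem integral_riemannianVolume (g : Metric (𝓡 n) M) (a : M) {h : M → ℝ}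
    (hc : ContinuousOn h (extChartAt (𝓡 n) a).source)
    (h0 : ∀ x ∉ (extChartAt (𝓡 n) a).source, h x = 0) :
    ∫ x, h x ∂riemannianVolume g =
      ∫ y in (extChartAt (𝓡 n) a).target, density g a y * h ((extChartAt (𝓡 n) a).symm y) := by
  have hd : AEMeasurable (density g a) (volume.restrict (extChartAt (𝓡 n) a).target) :=
    (density_contDiffOn g a).continuousOn.aemeasurable (isOpen_target a).measurableSet
  rw [← setIntegral_eq_integral_of_forall_compl_eq_zero h0]
  have hm := hc.aestronglyMeasurable (μ := riemannianVolume g)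
    (isOpen_extChartAt_source a).measurableSet
  rw [riemannianVolume_restrict] at hm ⊢
  rw [chartVolume] at hm ⊢
  rw [integral_map ((aemeasurable_symm a).mono_ac (withDensity_absolutelyContinuous _ _)) hm,
    integral_withDensity_eq_integral_toReal_smul₀ hd.ennreal_ofReal (by simp)]
  refine setIntegral_congr_fun (isOpen_target a).measurableSet fun y hy => ?_
  simp only [smul_eq_mul]
  rw [ENNReal.toReal_ofReal (density_pos g hy).le]

/-- Near `a` the density is bounded and the coordinates stay in a unit ball, so the measure is
locally finite; compactness does the rest. -/
instance isFiniteMeasure_riemannianVolume (g : Metric (𝓡 n) M) :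
    IsFiniteMeasure (riemannianVolume g) := by
  have : IsLocallyFiniteMeasure (riemannianVolume g) := by
    refine ⟨fun a => ?_⟩
    have h1 : ∀ᶠ y in 𝓝 (extChartAt (𝓡 n) a a),
        density g a y < density g a (extChartAt (𝓡 n) a a) + 1 :=
      ((density_contDiffOn g a).continuousOn.continuousAt
        ((isOpen_target a).mem_nhds (mem_extChartAt_target a))).eventually_lt_const (by simp)
    have h2 := h1.and (Metric.ball_mem_nhds (extChartAt (𝓡 n) a a) one_pos)
    have h3 := (continuousAt_extChartAt (I := 𝓡 n) a).eventually h2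
    obtain ⟨U, hU, hUo, haU⟩ := eventually_nhds_iff.1
      (h3.and ((isOpen_extChartAt_source a).mem_nhds (mem_extChartAt_source (I := 𝓡 n) a)))
    refine ⟨U, hUo.mem_nhds haU, ?_⟩
    rw [riemannianVolume_apply_eq_chartVolume g hUo.measurableSet fun x hx => (hU x hx).2,
      chartVolume_apply g a hUo.measurableSet]
    have h4 : ∀ y ∈ coordPreimage (n := n) a U,
        density g a y < density g a (extChartAt (𝓡 n) a a) + 1 ∧
          y ∈ Metric.ball (extChartAt (𝓡 n) a a) 1 := by
      intro y hy
      have := (hU _ hy.2).1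
      rwa [(extChartAt (𝓡 n) a).right_inv hy.1] at this
    calc _ ≤ ∫⁻ y in coordPreimage (n := n) a U,
          ENNReal.ofReal (density g a (extChartAt (𝓡 n) a a) + 1) :=
        setLIntegral_mono' (measurableSet_coordPreimage a hUo.measurableSet) fun y hy =>
          ENNReal.ofReal_le_ofReal (h4 y hy).1.le
      _ < ⊤ := by
        rw [setLIntegral_const]
        exact ENNReal.mul_lt_top ENNReal.ofReal_lt_top
          ((measure_mono fun y hy => (h4 y hy).2).trans_lt measure_ball_lt_top)
  exact ⟨isCompact_univ.measure_lt_top⟩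

/-- Holds because the density is positive; it turns almost-everywhere equality of continuous
functions into equality. -/
instance isOpenPosMeasure_riemannianVolume (g : Metric (𝓡 n) M) :
    (riemannianVolume g).IsOpenPosMeasure := by
  refine ⟨fun U hU hne h => ?_⟩
  obtain ⟨a, ha⟩ := hne
  have hV : IsOpen (U ∩ (extChartAt (𝓡 n) a).source) := hU.inter (isOpen_extChartAt_source a)
  have h1 := measure_mono_null (inter_subset_left (t := (extChartAt (𝓡 n) a).source)) h
  rw [riemannianVolume_apply_eq_chartVolume g hV.measurableSet inter_subset_right,
    chartVolume_apply g a hV.measurableSet] at h1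
  have hW := isOpen_coordPreimage (n := n) a hV
  have hd : AEMeasurable (density g a)
      (volume.restrict (coordPreimage a (U ∩ (extChartAt (𝓡 n) a).source))) :=
    ((density_contDiffOn g a).continuousOn.mono inter_subset_left).aemeasurable hW.measurableSet
  rw [lintegral_eq_zero_iff' hd.ennreal_ofReal, Filter.EventuallyEq,
    ae_restrict_iff' hW.measurableSet] at h1
  have h2 : volume (coordPreimage (n := n) a (U ∩ (extChartAt (𝓡 n) a).source)) = 0 := by
    refine measure_mono_null (fun y hy => ?_) (ae_iff.1 h1)
    simp only [mem_ofPred_eq, Pi.zero_apply, Classical.not_imp, ENNReal.ofReal_eq_zero, not_le]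
    exact ⟨hy, density_pos g hy.1⟩
  refine (hW.measure_pos volume ⟨extChartAt (𝓡 n) a a, mem_extChartAt_target a, ?_⟩).ne' h2
  rw [mem_preimage, extChartAt_to_inv]
  exact ⟨ha, mem_extChartAt_source a⟩

end Volume

/-! ### Integration by parts and gradients in charts. -/

section Gradient

theorem integrable_of_continuousOn_of_eq_zero {U K : Set (EuclideanSpace ℝ (Fin n))}
    (hK : IsCompact K) (hKU : K ⊆ U) {h : EuclideanSpace ℝ (Fin n) → ℝ} (hc : ContinuousOn h U)
    (h0 : ∀ y ∉ K, h y = 0) : Integrable h :=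
  (((hc.mono hKU).integrableOn_compact hK).integrable_of_forall_notMem_eq_zero h0)

/-- Integration by parts for a function `ψ` with compact support in an open set `U` on which
everything is `C¹`. -/
theorem setIntegral_mul_partialDeriv {U K : Set (EuclideanSpace ℝ (Fin n))} (hU : IsOpen U)
    (hK : IsCompact K) (hKU : K ⊆ U) {ψ W : EuclideanSpace ℝ (Fin n) → ℝ}
    (hψ : ContDiffOn ℝ 1 ψ U) (hW : ContDiffOn ℝ 1 W U) (h0 : ∀ y ∈ U, y ∉ K → ψ y = 0)
    (i : Fin n) :
    IntegrableOn (fun y => ψ y * partialDeriv (𝓡 n) i W y) U ∧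
    IntegrableOn (fun y => partialDeriv (𝓡 n) i ψ y * W y) U ∧
    ∫ y in U, ψ y * partialDeriv (𝓡 n) i W y = -∫ y in U, partialDeriv (𝓡 n) i ψ y * W y := by
  simp only [partialDeriv_eq]
  set v : EuclideanSpace ℝ (Fin n) := EuclideanSpace.single i 1
  -- The values of `ψ` outside `U` are arbitrary, so it is extended by zero. `W` needs no extension:
  -- its differentiability is only required on the support of `χ`.
  set χ : EuclideanSpace ℝ (Fin n) → ℝ := U.indicator ψ with hχ
  have hχU : ∀ y ∈ U, χ =ᶠ[𝓝 y] ψ := fun y hy => by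
    filter_upwards [hU.mem_nhds hy] with z hz using indicator_of_mem hz _
  have hχ0 : ∀ y ∉ K, χ y = 0 := fun y hy => by
    by_cases hyU : y ∈ U
    · rw [hχ, indicator_of_mem hyU, h0 y hyU hy]
    · exact indicator_of_notMem hyU _
  have hχK : ∀ y ∉ K, χ =ᶠ[𝓝 y] fun _ => 0 := fun y hy => by
    filter_upwards [hK.isClosed.isOpen_compl.mem_nhds hy] with z hz using hχ0 z hz
  have hdχ0 : ∀ y ∉ K, fderiv ℝ χ y v = 0 := fun y hy => by
    rw [(hχK y hy).fderiv_eq]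
    simp
  have hdχU : ∀ y ∈ U, fderiv ℝ χ y v = fderiv ℝ ψ y v := fun y hy => by
    rw [(hχU y hy).fderiv_eq]
  have hcψ : ContinuousOn (fun y => fderiv ℝ ψ y v) U :=
    (hψ.continuousOn_fderiv_of_isOpen hU le_rfl).clm_apply continuousOn_const
  have hcW : ContinuousOn (fun y => fderiv ℝ W y v) U :=
    (hW.continuousOn_fderiv_of_isOpen hU le_rfl).clm_apply continuousOn_const
  have hcχ : ContinuousOn χ U :=
    hψ.continuousOn.congr fun y hy => indicator_of_mem hy _
  have hcdχ : ContinuousOn (fun y => fderiv ℝ χ y v) U := hcψ.congr hdχU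
  have hχd : Differentiable ℝ χ := fun y => by
    by_cases hy : y ∈ K
    · exact (hχU y (hKU hy)).differentiableAt_iff.2
        ((hψ.differentiableOn (by simp)).differentiableAt (hU.mem_nhds (hKU hy)))
    · exact (hχK y hy).differentiableAt_iff.2 (differentiableAt_const _)
  have hsupp : tsupport χ ⊆ K := by
    refine closure_minimal (fun y hy => ?_) hK.isClosed
    by_contra h
    exact hy (hχ0 y h)
  have i1 : Integrable fun y => χ y * fderiv ℝ W y v :=
    integrable_of_continuousOn_of_eq_zero hK hKU (hcχ.mul hcW) fun y hy => by simp [hχ0 y hy]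
  have i2 : Integrable fun y => fderiv ℝ χ y v * W y :=
    integrable_of_continuousOn_of_eq_zero hK hKU (hcdχ.mul hW.continuousOn)
      fun y hy => by simp [hdχ0 y hy]
  have i3 : Integrable fun y => χ y * W y :=
    integrable_of_continuousOn_of_eq_zero hK hKU (hcχ.mul hW.continuousOn)
      fun y hy => by simp [hχ0 y hy]
  have e1 : EqOn (fun y => χ y * fderiv ℝ W y v) (fun y => ψ y * fderiv ℝ W y v) U :=
    fun y hy => by simp only [hχ, indicator_of_mem hy]
  have e2 : EqOn (fun y => fderiv ℝ χ y v * W y) (fun y => fderiv ℝ ψ y v * W y) U :=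
    fun y hy => by simp only [hdχU y hy]
  refine ⟨(i1.integrableOn (s := U)).congr_fun e1 hU.measurableSet,
    (i2.integrableOn (s := U)).congr_fun e2 hU.measurableSet, ?_⟩
  rw [← setIntegral_congr_fun hU.measurableSet e1, ← setIntegral_congr_fun hU.measurableSet e2,
    setIntegral_eq_integral_of_forall_compl_eq_zero, setIntegral_eq_integral_of_forall_compl_eq_zero]
  · exact integral_mul_fderiv_eq_neg_fderiv_mul_of_integrable i2 i1 i3 (fun x _ => hχd x)
      fun x hx => (hW.differentiableOn (by simp)).differentiableAt (hU.mem_nhds (hKU (hsupp hx)))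
  · exact fun y hy => by simp [hdχ0 y fun h => hy (hKU h)]
  · exact fun y hy => by simp [hχ0 y fun h => hy (hKU h)]

/-- The partial derivatives of `f` in the chart around `a`. -/
def partials (a : M) (f : M → ℝ) (y : EuclideanSpace ℝ (Fin n)) : Fin n → ℝ :=
  fun i => partialDeriv (𝓡 n) i (fun w => f ((extChartAt (𝓡 n) a).symm w)) y

theorem partials_eq_zero {a : M} {f : M → ℝ} {y : EuclideanSpace ℝ (Fin n)}
    (hy : y ∈ (extChartAt (𝓡 n) a).target)
    (hf : (extChartAt (𝓡 n) a).symm y ∉ tsupport f) : partials a f y = 0 := by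
  ext i
  have h1 : f =ᶠ[𝓝 ((extChartAt (𝓡 n) a).symm y)] fun _ => 0 :=
    notMem_tsupport_iff_eventuallyEq.1 hf
  have h2 : (fun w => f ((extChartAt (𝓡 n) a).symm w)) =ᶠ[𝓝 y] fun _ => 0 :=
    ((continuousOn_extChartAt_symm a).continuousAt ((isOpen_target a).mem_nhds hy)).eventually h1
  rw [partials, partialDeriv_eq, h2.fderiv_eq]
  simp

/-- For functions defined at `x` through the chart around `x`: a single chart must compute them near
a given point before continuity can be read off. -/
theorem continuous_of_chart {h : M → ℝ} {k : M → EuclideanSpace ℝ (Fin n) → ℝ}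
    (hk : ∀ a, ContinuousOn (k a) (extChartAt (𝓡 n) a).target)
    (hh : ∀ a, ∀ x ∈ (extChartAt (𝓡 n) a).source, h x = k a (extChartAt (𝓡 n) a x)) :
    Continuous h := by
  refine continuous_iff_continuousAt.2 fun a => ?_
  have h1 : ContinuousAt (fun x => k a (extChartAt (𝓡 n) a x)) a :=
    ContinuousAt.comp (g := k a) ((hk a).continuousAt
      ((isOpen_target a).mem_nhds (mem_extChartAt_target a))) (continuousAt_extChartAt a)
  refine h1.congr ?_
  filter_upwards [(isOpen_extChartAt_source a).mem_nhds (mem_extChartAt_source (I := 𝓡 n) a)]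
    with x hx using (hh a x hx).symm

variable [IsManifold (𝓡 n) ∞ M]

theorem contDiffOn_comp_symm {k : ℕ∞} (a : M) {f : M → ℝ} (hf : ContMDiff (𝓡 n) 𝓘(ℝ, ℝ) k f) :
    ContDiffOn ℝ k (fun w => f ((extChartAt (𝓡 n) a).symm w)) (extChartAt (𝓡 n) a).target := by
  have : ContMDiffOn 𝓘(ℝ, EuclideanSpace ℝ (Fin n)) (𝓡 n) k (extChartAt (𝓡 n) a).symm
      (extChartAt (𝓡 n) a).target :=
    (contMDiffOn_extChartAt_symm (n := ∞) a).of_le (by exact_mod_cast le_top)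
  exact (hf.comp_contMDiffOn this).contDiffOn

theorem contDiffOn_partials {k : ℕ∞} (a : M) {f : M → ℝ}
    (hf : ContMDiff (𝓡 n) 𝓘(ℝ, ℝ) ((k + 1 : ℕ∞)) f) (i : Fin n) :
    ContDiffOn ℝ k (fun y => partials a f y i) (extChartAt (𝓡 n) a).target := by
  simp only [partials, partialDeriv_eq]
  exact ((contDiffOn_comp_symm a hf).fderiv_of_isOpen (isOpen_target a) (by simp)).clm_apply
    contDiffOn_const

theorem partials_transition {a b : M} {f : M → ℝ} (hf : ContMDiff (𝓡 n) 𝓘(ℝ, ℝ) 1 f)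
    {y : EuclideanSpace ℝ (Fin n)} (hy : y ∈ coordPreimage b (extChartAt (𝓡 n) a).source) :
    partials b f y = (jacobian (transition a b) y).transpose.mulVec
      (partials a f (transition a b y)) := by
  ext i
  have h1 : (fun w => f ((extChartAt (𝓡 n) b).symm w)) =ᶠ[𝓝 y]
      fun w => f ((extChartAt (𝓡 n) a).symm (transition a b w)) := by
    filter_upwards [(isOpen_coordPreimage b (isOpen_extChartAt_source (I := 𝓡 n) a)).mem_nhds hy]
      with z hz
    rw [symm_transition hz]
  have h2 := partialDeriv_comp (h := fun w => f ((extChartAt (𝓡 n) a).symm w))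
    ((transition_contDiffAt hy).differentiableAt (by simp))
    (((contDiffOn_comp_symm (k := 1) a hf).differentiableOn (by simp)).differentiableAt
      ((isOpen_target a).mem_nhds (transition_mem hy).1)) i
  rw [partials, partialDeriv_eq, h1.fderiv_eq, ← partialDeriv_eq, h2]
  rfl

/-- The inner product of the gradients of `φ` and `f`, in the chart around `a`. -/
def gradInnerChart (g : Metric (𝓡 n) M) (a : M) (φ f : M → ℝ) (y : EuclideanSpace ℝ (Fin n)) : ℝ :=
  partials a φ y ⬝ᵥ ((gramMatrix g a y)⁻¹.mulVec (partials a f y))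

/-- The inner product of the gradients of `φ` and `f`. -/
def gradInner (g : Metric (𝓡 n) M) (φ f : M → ℝ) (x : M) : ℝ :=
  gradInnerChart g x φ f (extChartAt (𝓡 n) x x)

/-- Differentials transform by `Jᵀ` and the inverse Gram matrix by `J⁻¹ · J⁻ᵀ`, so all Jacobians
cancel. -/
theorem gradInnerChart_transition (g : Metric (𝓡 n) M) {a b : M} {φ f : M → ℝ}
    (hφ : ContMDiff (𝓡 n) 𝓘(ℝ, ℝ) 1 φ) (hf : ContMDiff (𝓡 n) 𝓘(ℝ, ℝ) 1 f)
    {y : EuclideanSpace ℝ (Fin n)} (hy : y ∈ coordPreimage b (extChartAt (𝓡 n) a).source) :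
    gradInnerChart g b φ f y = gradInnerChart g a φ f (transition a b y) := by
  -- A singular `J` would make `det G_b = 0`, against positive definiteness.
  have hJ : IsUnit (jacobian (transition a b) y) := by
    rw [Matrix.isUnit_iff_isUnit_det, isUnit_iff_ne_zero]
    intro h
    have := (gramMatrix_posDef g hy.1).det_pos
    rw [gramMatrix_transition g hy, Matrix.det_mul, h, mul_zero] at this
    exact lt_irrefl _ this
  have hJt : IsUnit (jacobian (transition a b) y).transpose.det := by
    rwa [Matrix.det_transpose, ← Matrix.isUnit_iff_isUnit_det]
  rw [gradInnerChart, gradInnerChart, partials_transition hφ hy, partials_transition hf hy,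
    gramMatrix_transition g hy, Matrix.mul_inv_rev, Matrix.mul_inv_rev, Matrix.mulVec_mulVec,
    Matrix.mul_assoc, Matrix.mul_assoc, Matrix.nonsing_inv_mul _ hJt, Matrix.mul_one,
    Matrix.mulVec_transpose, ← Matrix.dotProduct_mulVec, Matrix.mulVec_mulVec, ← Matrix.mul_assoc,
    Matrix.mul_nonsing_inv _ ((Matrix.isUnit_iff_isUnit_det _).1 hJ), Matrix.one_mul]

theorem gradInner_eq (g : Metric (𝓡 n) M) {a x : M} {φ f : M → ℝ}
    (hφ : ContMDiff (𝓡 n) 𝓘(ℝ, ℝ) 1 φ) (hf : ContMDiff (𝓡 n) 𝓘(ℝ, ℝ) 1 f)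
    (hx : x ∈ (extChartAt (𝓡 n) a).source) :
    gradInner g φ f x = gradInnerChart g a φ f (extChartAt (𝓡 n) a x) := by
  have hy : extChartAt (𝓡 n) x x ∈ coordPreimage x (extChartAt (𝓡 n) a).source := by
    refine ⟨mem_extChartAt_target x, ?_⟩
    rwa [mem_preimage, extChartAt_to_inv]
  rw [gradInner, gradInnerChart_transition g hφ hf hy, transition, extChartAt_to_inv]

theorem continuousOn_gradInnerChart (g : Metric (𝓡 n) M) (a : M) {φ f : M → ℝ}
    (hφ : ContMDiff (𝓡 n) 𝓘(ℝ, ℝ) 1 φ) (hf : ContMDiff (𝓡 n) 𝓘(ℝ, ℝ) 1 f) :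
    ContinuousOn (gradInnerChart g a φ f) (extChartAt (𝓡 n) a).target := by
  change ContinuousOn (fun y => ∑ i, partials a φ y i *
    ∑ j, (gramMatrix g a y)⁻¹ i j * partials a f y j) _
  exact continuousOn_finsetSum _ fun i _ =>
    ((contDiffOn_partials (k := 0) a (by simpa using hφ) i).continuousOn).mul <|
    continuousOn_finsetSum _ fun j _ => (gramMatrix_inv_contDiffOn g a i j).continuousOn.mul
      (contDiffOn_partials (k := 0) a (by simpa using hf) j).continuousOn

theorem continuous_gradInner (g : Metric (𝓡 n) M) {φ f : M → ℝ}
    (hφ : ContMDiff (𝓡 n) 𝓘(ℝ, ℝ) 1 φ) (hf : ContMDiff (𝓡 n) 𝓘(ℝ, ℝ) 1 f) :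
    Continuous (gradInner g φ f) :=
  continuous_of_chart (fun a => continuousOn_gradInnerChart g a hφ hf)
    fun _ _ hx => gradInner_eq g hφ hf hx

theorem gradInner_self_nonneg (g : Metric (𝓡 n) M) (f : M → ℝ) (x : M) : 0 ≤ gradInner g f f x := by
  have := (gramMatrix_posDef g (mem_extChartAt_target x)).inv.posSemidef.dotProduct_mulVec_nonneg
    (partials x f (extChartAt (𝓡 n) x x))
  rwa [star_trivial] at this

theorem chartLaplacian_eq (g : Metric (𝓡 n) M) (a : M) (f : M → ℝ) (y : EuclideanSpace ℝ (Fin n)) :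
    chartLaplacian g a f y = (density g a y)⁻¹ * ∑ i, ∑ j, partialDeriv (𝓡 n) i
      (fun z => density g a z * (gramMatrix g a z)⁻¹ i j * partials a f z j) y := rfl

theorem contDiffOn_flux (g : Metric (𝓡 n) M) (a : M) {f : M → ℝ}
    (hf : ContMDiff (𝓡 n) 𝓘(ℝ, ℝ) 2 f) (i j : Fin n) :
    ContDiffOn ℝ 1 (fun z => density g a z * (gramMatrix g a z)⁻¹ i j * partials a f z j)
      (extChartAt (𝓡 n) a).target :=
  (((density_contDiffOn g a).mul (gramMatrix_inv_contDiffOn g a i j)).of_le (by simp)).mul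
    (contDiffOn_partials (k := 1) a hf j)

theorem continuousOn_chartLaplacian (g : Metric (𝓡 n) M) (a : M) {f : M → ℝ}
    (hf : ContMDiff (𝓡 n) 𝓘(ℝ, ℝ) 2 f) :
    ContinuousOn (chartLaplacian g a f) (extChartAt (𝓡 n) a).target := by
  refine ContinuousOn.mul ?_ ?_
  · exact (density_contDiffOn g a).continuousOn.inv₀ fun y hy => (density_pos g hy).ne'
  · refine continuousOn_finsetSum _ fun i _ => continuousOn_finsetSum _ fun j _ => ?_
    refine ContinuousOn.congr ?_ fun y _ => partialDeriv_eq i _ y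
    exact ((contDiffOn_flux g a hf i j).continuousOn_fderiv_of_isOpen (isOpen_target a)
      le_rfl).clm_apply continuousOn_const

theorem setIntegral_mul_chartLaplacian [CompactSpace M] (g : Metric (𝓡 n) M) (a : M) {φ f : M → ℝ}
    (hφ : ContMDiff (𝓡 n) 𝓘(ℝ, ℝ) 1 φ) (hf : ContMDiff (𝓡 n) 𝓘(ℝ, ℝ) 2 f)
    (hs : tsupport φ ⊆ (extChartAt (𝓡 n) a).source) :
    ∫ y in (extChartAt (𝓡 n) a).target,
        density g a y * (φ ((extChartAt (𝓡 n) a).symm y) * chartLaplacian g a f y) =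
      -∫ y in (extChartAt (𝓡 n) a).target, density g a y * gradInnerChart g a φ f y := by
  have hKc : IsCompact (extChartAt (𝓡 n) a '' tsupport φ) :=
    (isClosed_tsupport φ).isCompact.image_of_continuousOn ((continuousOn_extChartAt a).mono hs)
  have hKU : extChartAt (𝓡 n) a '' tsupport φ ⊆ (extChartAt (𝓡 n) a).target := by
    rintro _ ⟨x, hx, rfl⟩
    exact (extChartAt (𝓡 n) a).map_source (hs hx)
  have h0 : ∀ y ∈ (extChartAt (𝓡 n) a).target, y ∉ extChartAt (𝓡 n) a '' tsupport φ →
      φ ((extChartAt (𝓡 n) a).symm y) = 0 := by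
    intro y hy hyK
    by_contra h
    exact hyK ⟨_, subset_tsupport φ h, (extChartAt (𝓡 n) a).right_inv hy⟩
  have key := fun i j => setIntegral_mul_partialDeriv (isOpen_target a) hKc hKU
    (contDiffOn_comp_symm (k := 1) a hφ) (contDiffOn_flux g a hf i j) h0 i
  change ∀ i j, _ ∧ IntegrableOn (fun y => partials a φ y i * _) _ ∧
    _ = -∫ y in (extChartAt (𝓡 n) a).target, partials a φ y i * _ at key
  have hm := (isOpen_target (n := n) a).measurableSet
  calc _ = ∫ y in (extChartAt (𝓡 n) a).target, ∑ i, ∑ j, φ ((extChartAt (𝓡 n) a).symm y) *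
        partialDeriv (𝓡 n) i (fun z => density g a z * (gramMatrix g a z)⁻¹ i j *
          partials a f z j) y := by
        -- The volume density cancels the factor `(det g)^(-1/2)` of the Laplacian and leaves a pure
        -- divergence.
        refine setIntegral_congr_fun hm fun y hy => ?_
        have := (density_pos g hy).ne'
        simp only [chartLaplacian_eq, ← Finset.mul_sum]
        field_simp
    _ = -∫ y in (extChartAt (𝓡 n) a).target, ∑ i, ∑ j, partials a φ y i *
        (density g a y * (gramMatrix g a y)⁻¹ i j * partials a f y j) := by
        rw [integral_finsetSum _ fun i _ => integrable_finsetSum _ fun j _ => (key i j).1,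
          integral_finsetSum _ fun i _ => integrable_finsetSum _ fun j _ => (key i j).2.1,
          ← Finset.sum_neg_distrib]
        refine Finset.sum_congr rfl fun i _ => ?_
        rw [integral_finsetSum _ fun j _ => (key i j).1,
          integral_finsetSum _ fun j _ => (key i j).2.1, ← Finset.sum_neg_distrib]
        exact Finset.sum_congr rfl fun j _ => (key i j).2.2
    _ = _ := by
        congr 2
        ext y
        simp only [gradInnerChart, dotProduct, Matrix.mulVec, Finset.mul_sum]
        refine Finset.sum_congr rfl fun i _ => Finset.sum_congr rfl fun j _ => ?_
        ring

end Gradient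

/-! ### Green's formula and chart independence of the Laplacian. -/

section Green

theorem continuous_mul_of_tsupport_subset {U : Set M} (hU : IsOpen U) {φ h : M → ℝ}
    (hφ : Continuous φ) (hs : tsupport φ ⊆ U) (hh : ContinuousOn h U) :
    Continuous fun x => φ x * h x :=
  (hφ.continuousOn.mul hh).continuous_of_tsupport_subset hU
    ((tsupport_mul_subset_left).trans hs)

variable [IsManifold (𝓡 n) ∞ M]

theorem continuousOn_chartLaplacian_comp (g : Metric (𝓡 n) M) (a : M) {f : M → ℝ}
    (hf : ContMDiff (𝓡 n) 𝓘(ℝ, ℝ) 2 f) :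
    ContinuousOn (fun x => chartLaplacian g a f (extChartAt (𝓡 n) a x))
      (extChartAt (𝓡 n) a).source :=
  (continuousOn_chartLaplacian g a hf).comp (continuousOn_extChartAt a)
    fun _ hx => (extChartAt (𝓡 n) a).map_source hx

theorem partials_sum {ι : Type*} (s : Finset ι) (a : M) {φ : ι → M → ℝ}
    (hφ : ∀ i ∈ s, ContMDiff (𝓡 n) 𝓘(ℝ, ℝ) 1 (φ i)) {y : EuclideanSpace ℝ (Fin n)}
    (hy : y ∈ (extChartAt (𝓡 n) a).target) :
    partials a (fun x => ∑ i ∈ s, φ i x) y = ∑ i ∈ s, partials a (φ i) y := by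
  ext k
  simp only [partials, Finset.sum_apply, partialDeriv_eq]
  rw [fderiv_fun_sum fun i hi => ((contDiffOn_comp_symm (k := 1) a (hφ i hi)).differentiableOn
    (by simp)).differentiableAt ((isOpen_target a).mem_nhds hy)]
  simp

variable [MeasurableSpace M] [BorelSpace M] [T2Space M] [CompactSpace M]

/-- Green's formula for a function `φ` supported in the domain of the chart around `a`. -/
theorem integral_mul_chartLaplacian (g : Metric (𝓡 n) M) (a : M) {φ f : M → ℝ}
    (hφ : ContMDiff (𝓡 n) 𝓘(ℝ, ℝ) 1 φ) (hf : ContMDiff (𝓡 n) 𝓘(ℝ, ℝ) 2 f)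
    (hs : tsupport φ ⊆ (extChartAt (𝓡 n) a).source) :
    ∫ x, φ x * chartLaplacian g a f (extChartAt (𝓡 n) a x) ∂riemannianVolume g =
      -∫ x, gradInner g φ f x ∂riemannianVolume g := by
  have hf1 : ContMDiff (𝓡 n) 𝓘(ℝ, ℝ) 1 f := hf.of_le (by norm_num)
  have hm := (isOpen_target (n := n) a).measurableSet
  rw [integral_riemannianVolume g a
      (h := fun x => φ x * chartLaplacian g a f (extChartAt (𝓡 n) a x))
      (hφ.continuous.continuousOn.mul (continuousOn_chartLaplacian_comp g a hf)),
    integral_riemannianVolume g a (continuous_gradInner g hφ hf1).continuousOn]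
  · refine (setIntegral_congr_fun hm fun y hy => ?_).trans
      ((setIntegral_mul_chartLaplacian g a hφ hf hs).trans
        (congrArg Neg.neg (setIntegral_congr_fun hm fun y hy => ?_)))
    · simp only [(extChartAt (𝓡 n) a).right_inv hy]
    · simp only [gradInner_eq g hφ hf1 ((extChartAt (𝓡 n) a).map_target hy),
        (extChartAt (𝓡 n) a).right_inv hy]
  · intro x hx
    rw [gradInner, gradInnerChart, partials_eq_zero (mem_extChartAt_target x), zero_dotProduct]
    rw [extChartAt_to_inv]
    exact fun h => hx (hs h)
  · intro x hx
    rw [image_eq_zero_of_notMem_tsupport fun h => hx (hs h), zero_mul]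

theorem integrable_of_continuous (g : Metric (𝓡 n) M) {h : M → ℝ} (hh : Continuous h) :
    Integrable h (riemannianVolume g) :=
  integrableOn_univ.1 (hh.continuousOn.integrableOn_compact isCompact_univ)

/-- Against a test function `φ` supported in both chart domains, both sides integrate to `-∫
gradInner g φ f`. Hence they agree almost everywhere on the overlap, and everywhere by continuity.
-/
theorem chartLaplacian_eq_of_mem (g : Metric (𝓡 n) M) {a b x : M} {f : M → ℝ}
    (hf : ContMDiff (𝓡 n) 𝓘(ℝ, ℝ) 2 f) (ha : x ∈ (extChartAt (𝓡 n) a).source)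
    (hb : x ∈ (extChartAt (𝓡 n) b).source) :
    chartLaplacian g a f (extChartAt (𝓡 n) a x) = chartLaplacian g b f (extChartAt (𝓡 n) b x) := by
  set U := (extChartAt (𝓡 n) a).source ∩ (extChartAt (𝓡 n) b).source with hUdef
  have hU : IsOpen U := (isOpen_extChartAt_source a).inter (isOpen_extChartAt_source b)
  have hca := (continuousOn_chartLaplacian_comp g a hf).mono (inter_subset_left : U ⊆ _)
  have hcb := (continuousOn_chartLaplacian_comp g b hf).mono (inter_subset_right : U ⊆ _)
  have h0 := hU.ae_eq_zero_of_integral_contMDiff_smul_eq_zero (𝓡 n) (μ := riemannianVolume g)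
    ((hca.sub hcb).locallyIntegrableOn hU.measurableSet) fun φ hφ _ hs => by
      have hφ1 : ContMDiff (𝓡 n) 𝓘(ℝ, ℝ) 1 φ := hφ.of_le (by norm_num)
      change ∫ x, φ x * (chartLaplacian g a f (extChartAt (𝓡 n) a x) -
        chartLaplacian g b f (extChartAt (𝓡 n) b x)) ∂riemannianVolume g = 0
      simp only [mul_sub]
      rw [integral_sub
        (integrable_of_continuous g (continuous_mul_of_tsupport_subset hU hφ.continuous hs hca))
        (integrable_of_continuous g (continuous_mul_of_tsupport_subset hU hφ.continuous hs hcb)),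
        integral_mul_chartLaplacian g a hφ1 hf (hs.trans inter_subset_left),
        integral_mul_chartLaplacian g b hφ1 hf (hs.trans inter_subset_right), sub_self]
  have h1 : (fun x => chartLaplacian g a f (extChartAt (𝓡 n) a x) -
      chartLaplacian g b f (extChartAt (𝓡 n) b x)) =ᵐ[(riemannianVolume g).restrict U] 0 :=
    (ae_restrict_iff' hU.measurableSet).2 h0
  exact sub_eq_zero.1 (Measure.eqOn_open_of_ae_eq h1 hU (hca.sub hcb) continuousOn_const ⟨ha, hb⟩)

theorem laplacian_eq (g : Metric (𝓡 n) M) {a x : M} {f : M → ℝ}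
    (hf : ContMDiff (𝓡 n) 𝓘(ℝ, ℝ) 2 f) (ha : x ∈ (extChartAt (𝓡 n) a).source) :
    laplacian g f x = chartLaplacian g a f (extChartAt (𝓡 n) a x) :=
  chartLaplacian_eq_of_mem g hf (mem_extChartAt_source x) ha

theorem continuous_laplacian (g : Metric (𝓡 n) M) {f : M → ℝ}
    (hf : ContMDiff (𝓡 n) 𝓘(ℝ, ℝ) 2 f) : Continuous (laplacian g f) :=
  continuous_of_chart (fun a => continuousOn_chartLaplacian g a hf) fun _ _ hx => laplacian_eq g hf hx

/-- Green's formula on a compact manifold without boundary. -/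
theorem integral_mul_laplacian (g : Metric (𝓡 n) M) {φ f : M → ℝ}
    (hφ : ContMDiff (𝓡 n) 𝓘(ℝ, ℝ) 1 φ) (hf : ContMDiff (𝓡 n) 𝓘(ℝ, ℝ) 2 f) :
    ∫ x, φ x * laplacian g f x ∂riemannianVolume g =
      -∫ x, gradInner g φ f x ∂riemannianVolume g := by
  have hf1 : ContMDiff (𝓡 n) 𝓘(ℝ, ℝ) 1 f := hf.of_le (by norm_num)
  -- `φ` is cut into pieces supported in single charts; both sides are linear in `φ`.
  set ψ : M → M → ℝ := fun b x => chartPartition (𝓡 n) M b x * φ x with hψdef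
  have hψ : ∀ b, ContMDiff (𝓡 n) 𝓘(ℝ, ℝ) 1 (ψ b) := fun b =>
    ((chartPartition (𝓡 n) M b).contMDiff.of_le (by norm_num)).mul hφ
  have hsum : φ = fun x => ∑ b ∈ chartIndices n M, ψ b x := by
    ext x
    simp only [hψdef, ← Finset.sum_mul, sum_chartPartition, one_mul]
  have hgrad : ∀ x, gradInner g φ f x = ∑ b ∈ chartIndices n M, gradInner g (ψ b) f x := by
    intro x
    simp only [gradInner, gradInnerChart]
    conv_lhs => rw [hsum, partials_sum _ x (fun b _ => hψ b) (mem_extChartAt_target x)]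
    rw [sum_dotProduct]
  have hs : ∀ b, tsupport (ψ b) ⊆ (extChartAt (𝓡 n) b).source := fun b =>
    (tsupport_mul_subset_left).trans (chartPartition_tsupport b)
  have hchart : ∀ b, ∫ x, ψ b x * laplacian g f x ∂riemannianVolume g =
      -∫ x, gradInner g (ψ b) f x ∂riemannianVolume g := by
    intro b
    rw [← integral_mul_chartLaplacian g b (hψ b) hf (hs b)]
    congr 1
    ext x
    by_cases hx : x ∈ (extChartAt (𝓡 n) b).source
    · rw [laplacian_eq g hf hx]
    · rw [image_eq_zero_of_notMem_tsupport fun h => hx (hs b h), zero_mul, zero_mul]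
  simp only [hgrad]
  rw [integral_finsetSum _ fun b _ => integrable_of_continuous g (continuous_gradInner g (hψ b) hf1),
    ← Finset.sum_neg_distrib]
  simp only [← hchart]
  rw [← integral_finsetSum (f := fun b x => ψ b x * laplacian g f x) _
    fun b _ => integrable_of_continuous g ((hψ b).continuous.mul (continuous_laplacian g hf))]
  congr 1
  ext x
  rw [← Finset.sum_mul]
  exact congrArg (· * _) (congrFun hsum x)

theorem integral_sub_const_mul_laplacian_nonpos (g : Metric (𝓡 n) M) (c : ℝ) {f : M → ℝ}
    (hf : ContMDiff (𝓡 n) 𝓘(ℝ, ℝ) 2 f) :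
    ∫ x, (f x - c) * laplacian g f x ∂riemannianVolume g ≤ 0 := by
  have hf1 : ContMDiff (𝓡 n) 𝓘(ℝ, ℝ) 1 f := hf.of_le (by norm_num)
  rw [integral_mul_laplacian g (hf1.sub contMDiff_const) hf, neg_nonpos]
  refine integral_nonneg fun x => ?_
  have h1 : partials x (fun z => f z - c) (extChartAt (𝓡 n) x x) =
      partials x f (extChartAt (𝓡 n) x x) := by
    ext i
    simp only [partials, partialDeriv_eq, fderiv_sub_const]
  have h2 := gradInner_self_nonneg g f x
  simp only [gradInner, gradInnerChart, h1] at h2 ⊢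
  exact h2

end Green

/-! ### Energy decay, uniqueness and heat content. -/

section HeatEquation

section Slices

variable {v : M → ℝ → ℝ}

theorem contMDiff_slice
    (hv : ContMDiffOn ((𝓡 n).prod 𝓘(ℝ, ℝ)) 𝓘(ℝ, ℝ) 2 (fun p : M × ℝ => v p.1 p.2)
      (univ ×ˢ Ioi 0)) {t : ℝ} (ht : 0 < t) : ContMDiff (𝓡 n) 𝓘(ℝ, ℝ) 2 fun x => v x t := by
  have h1 : ContMDiff (𝓡 n) ((𝓡 n).prod 𝓘(ℝ, ℝ)) 2 fun x : M => (x, t) :=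
    contMDiff_id.prodMk contMDiff_const
  exact contMDiffOn_univ.1 (hv.comp h1.contMDiffOn fun x _ => ⟨mem_univ x, ht⟩)

variable [IsManifold (𝓡 n) ∞ M]

/-- Joint continuity in space and time supplies the dominating constant in `hasDerivAt_energy`. -/
theorem continuousOn_deriv_time
    (hv : ContMDiffOn ((𝓡 n).prod 𝓘(ℝ, ℝ)) 𝓘(ℝ, ℝ) 2 (fun p : M × ℝ => v p.1 p.2)
      (univ ×ˢ Ioi 0)) :
    ContinuousOn (fun p : M × ℝ => deriv (fun s => v p.1 s) p.2) (univ ×ˢ Ioi 0) := by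
  rintro ⟨a, t⟩ ⟨-, ht⟩
  refine ContinuousAt.continuousWithinAt ?_
  set U : Set (EuclideanSpace ℝ (Fin n) × ℝ) := (extChartAt (𝓡 n) a).target ×ˢ Ioi 0 with hU
  set V : EuclideanSpace ℝ (Fin n) × ℝ → ℝ := fun q => v ((extChartAt (𝓡 n) a).symm q.1) q.2 with hV
  have hUo : IsOpen U := (isOpen_target a).prod isOpen_Ioi
  have h1 : ContMDiffOn 𝓘(ℝ, EuclideanSpace ℝ (Fin n) × ℝ) (𝓡 n) 2
      (fun q : EuclideanSpace ℝ (Fin n) × ℝ => (extChartAt (𝓡 n) a).symm q.1) U :=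
    (contMDiffOn_extChartAt_symm (I := 𝓡 n) (n := 2) a).comp
      (contDiff_fst.contMDiff.contMDiffOn) fun q hq => hq.1
  have h2 : ContMDiffOn 𝓘(ℝ, EuclideanSpace ℝ (Fin n) × ℝ) 𝓘(ℝ, ℝ) 2
      (fun q : EuclideanSpace ℝ (Fin n) × ℝ => q.2) U := contDiff_snd.contMDiff.contMDiffOn
  have h3 : ContDiffOn ℝ 2 V U :=
    (hv.comp (h1.prodMk h2) fun q hq => ⟨mem_univ _, hq.2⟩).contDiffOn
  have h4 : ContinuousOn (fun q => fderiv ℝ V q (0, 1)) U :=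
    (h3.continuousOn_fderiv_of_isOpen hUo (by norm_num)).clm_apply continuousOn_const
  have h5 : ∀ q ∈ U, deriv (fun s => v ((extChartAt (𝓡 n) a).symm q.1) s) q.2 =
      fderiv ℝ V q (0, 1) := by
    rintro ⟨y, s⟩ hq
    have h6 : HasFDerivAt V (fderiv ℝ V (y, s)) (y, s) :=
      ((h3.differentiableOn (by simp)).differentiableAt (hUo.mem_nhds hq)).hasFDerivAt
    have h7 : HasDerivAt (fun s : ℝ => (y, s)) ((0 : EuclideanSpace ℝ (Fin n)), (1 : ℝ)) s :=
      (hasDerivAt_const s y).prodMk (hasDerivAt_id s)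
    exact (h6.comp_hasDerivAt s h7).deriv
  have h8 : ContinuousAt (fun p : M × ℝ => (extChartAt (𝓡 n) a p.1, p.2)) (a, t) :=
    (ContinuousAt.comp (f := Prod.fst) (g := extChartAt (𝓡 n) a) (continuousAt_extChartAt a)
      continuousAt_fst).prodMk continuousAt_snd
  have h9 : ContinuousAt (fun p : M × ℝ => fderiv ℝ V (extChartAt (𝓡 n) a p.1, p.2) (0, 1)) (a, t) :=
    ContinuousAt.comp (g := fun q => fderiv ℝ V q (0, 1))
      (h4.continuousAt (hUo.mem_nhds ⟨mem_extChartAt_target a, ht⟩)) h8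
  refine h9.congr ?_
  filter_upwards [((isOpen_extChartAt_source (I := 𝓡 n) a).prod isOpen_Ioi).mem_nhds
    (show (a, t) ∈ (extChartAt (𝓡 n) a).source ×ˢ Ioi 0 from ⟨mem_extChartAt_source a, ht⟩)] with p hp
  rw [← h5 _ ⟨(extChartAt (𝓡 n) a).map_source hp.1, hp.2⟩]
  simp only [(extChartAt (𝓡 n) a).left_inv hp.1]

end Slices

theorem isHeatSolution_one [IsManifold (𝓡 n) ∞ M] [MeasurableSpace M] [T2Space M] [CompactSpace M]
    (g : Metric (𝓡 n) M) : IsHeatSolution g fun _ _ => 1 where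
  regular := contMDiffOn_const
  heat_eq x t _ := by
    have : laplacian g (fun _ => (1 : ℝ)) x = 0 := by
      simp [laplacian, chartLaplacian, partialDeriv]
    rw [this]
    exact hasDerivAt_const t 1
  initial _ := rfl
  tendsto_initial := by simp
  dirichlet x hx := by
    rw [ModelWithCorners.Boundaryless.boundary_eq_empty] at hx
    exact hx.elim

variable [IsManifold (𝓡 n) ∞ M] [MeasurableSpace M] [BorelSpace M] [T2Space M] [CompactSpace M]

variable {g : Metric (𝓡 n) M} {v : M → ℝ → ℝ}

theorem hasDerivAt_energy (hv : IsHeatSolution g v) {t : ℝ} (ht : 0 < t) :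
    HasDerivAt (fun s => ∫ x, (v x s - 1) ^ 2 ∂riemannianVolume g)
      (∫ x, 2 * ((v x t - 1) * laplacian g (fun z => v z t) x) ∂riemannianVolume g) t := by
  have hc : ∀ s > 0, Continuous fun x => v x s := fun s hs =>
    (contMDiff_slice hv.regular hs).continuous
  have hcl : ∀ s > 0, Continuous (laplacian g fun z => v z s) := fun s hs =>
    continuous_laplacian g (contMDiff_slice hv.regular hs)
  have hcF : ContinuousOn (fun p : M × ℝ => 2 * ((v p.1 p.2 - 1) * deriv (fun s => v p.1 s) p.2))
      (univ ×ˢ Ioi 0) :=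
    continuousOn_const.mul
      ((hv.regular.continuousOn.sub continuousOn_const).mul (continuousOn_deriv_time hv.regular))
  -- This compact set stays away from time `0`, so the time derivative of the integrand is bounded
  -- on it by a constant `C`, integrable because the volume is finite.
  have hK : IsCompact ((univ : Set M) ×ˢ Icc (t / 2) (2 * t)) := isCompact_univ.prod isCompact_Icc
  obtain ⟨C, hC⟩ := hK.exists_bound_of_continuousOn
    (hcF.mono (prod_mono_right fun s hs => (half_pos ht).trans_le hs.1))
  have hpos : ∀ s ∈ Ioo (t / 2) (2 * t), 0 < s := fun s hs => (half_pos ht).trans hs.1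
  refine (hasDerivAt_integral_of_dominated_loc_of_deriv_le (bound := fun _ => C)
    (F' := fun s x => 2 * ((v x s - 1) * laplacian g (fun z => v z s) x))
    (Ioo_mem_nhds (half_lt_self ht) (by linarith : t < 2 * t)) ?_ ?_ ?_ ?_ ?_ ?_).2
  · filter_upwards [lt_mem_nhds ht] with s hs
    exact (integrable_of_continuous g (((hc s hs).sub continuous_const).pow 2)).aestronglyMeasurable
  · exact integrable_of_continuous g (((hc t ht).sub continuous_const).pow 2)
  · exact (integrable_of_continuous g (continuous_const.mul
      (((hc t ht).sub continuous_const).mul (hcl t ht)))).aestronglyMeasurable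
  · refine Eventually.of_forall fun x s hs => ?_
    have := hC (x, s) ⟨mem_univ x, hs.1.le, hs.2.le⟩
    rwa [(hv.heat_eq x s (hpos s hs)).deriv] at this
  · exact integrable_const C
  · refine Eventually.of_forall fun x s hs => ?_
    have := ((hv.heat_eq x s (hpos s hs)).sub_const 1).pow 2
    refine this.congr_deriv ?_
    push_cast
    ring

theorem energy_antitoneOn (hv : IsHeatSolution g v) :
    AntitoneOn (fun s => ∫ x, (v x s - 1) ^ 2 ∂riemannianVolume g) (Ioi 0) := by
  refine antitoneOn_of_deriv_nonpos (convex_Ioi 0)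
    (fun t ht => (hasDerivAt_energy hv ht).continuousAt.continuousWithinAt) ?_ ?_
  · rw [interior_Ioi]
    exact fun t ht => (hasDerivAt_energy hv ht).differentiableAt.differentiableWithinAt
  · rw [interior_Ioi]
    intro t ht
    rw [(hasDerivAt_energy hv ht).deriv, integral_const_mul]
    exact mul_nonpos_of_nonneg_of_nonpos zero_le_two
      (integral_sub_const_mul_laplacian_nonpos g 1 (contMDiff_slice hv.regular ht))

theorem eLpNorm_sq_eq_energy (hv : IsHeatSolution g v) {t : ℝ} (ht : 0 < t) :
    eLpNorm (fun x => v x t - 1) 2 (riemannianVolume g) ^ 2 =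
      ENNReal.ofReal (∫ x, (v x t - 1) ^ 2 ∂riemannianVolume g) := by
  have hc : Continuous fun x => v x t - 1 :=
    (contMDiff_slice hv.regular ht).continuous.sub continuous_const
  have h1 := eLpNorm_nnreal_pow_eq_lintegral (μ := riemannianVolume g) (f := fun x => v x t - 1)
    (p := 2) two_ne_zero
  rw [ofReal_integral_eq_lintegral_ofReal (f := fun x => (v x t - 1) ^ 2)
    (integrable_of_continuous g (hc.pow 2))
    (Eventually.of_forall fun x => sq_nonneg _)]
  norm_num at h1
  rw [h1]
  refine lintegral_congr fun x => ?_
  rw [← sq_abs, ENNReal.ofReal_pow (abs_nonneg _), ← Real.enorm_eq_ofReal_abs]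

theorem IsHeatSolution.eq_one (hv : IsHeatSolution g v) (x : M) {t : ℝ} (ht : 0 ≤ t) :
    v x t = 1 := by
  rcases ht.eq_or_lt with rfl | ht
  · exact hv.initial x
  have hc : Continuous fun x => v x t - 1 :=
    (contMDiff_slice hv.regular ht).continuous.sub continuous_const
  -- The energy at `t` is at most that at any earlier `s > 0`, which tends to `0` by the initial
  -- condition.
  have h1 : ∀ᶠ s in 𝓝[>] (0 : ℝ), eLpNorm (fun x => v x t - 1) 2 (riemannianVolume g) ≤
      eLpNorm (fun x => v x s - 1) 2 (riemannianVolume g) := by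
    filter_upwards [Ioo_mem_nhdsGT ht] with s hs
    rw [← ENNReal.pow_le_pow_left_iff two_ne_zero, eLpNorm_sq_eq_energy hv ht,
      eLpNorm_sq_eq_energy hv hs.1]
    exact ENNReal.ofReal_le_ofReal (energy_antitoneOn hv hs.1 ht hs.2.le)
  have h2 : eLpNorm (fun x => v x t - 1) 2 (riemannianVolume g) = 0 :=
    le_antisymm (ge_of_tendsto hv.tendsto_initial h1) zero_le
  rw [eLpNorm_eq_zero_iff (integrable_of_continuous g hc).aestronglyMeasurable two_ne_zero] at h2
  have h3 := (Continuous.ae_eq_iff_eq (riemannianVolume g) hc continuous_const).1 h2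
  exact sub_eq_zero.1 (congrFun h3 x)

theorem hasUniqueHeatSolution (g : Metric (𝓡 n) M) : HasUniqueHeatSolution g :=
  ⟨_, isHeatSolution_one g, fun _ hv x _ ht => hv.eq_one x ht⟩

theorem heatContent_eq_volume (g : Metric (𝓡 n) M) {t : ℝ} (ht : 0 ≤ t) :
    heatContent g t = (riemannianVolume g).real univ := by
  -- The function chosen by `Classical.epsilon` is a solution because the constant `1` is one;
  -- uniqueness then identifies it.
  have h : IsHeatSolution g (heatSolution g) := Classical.epsilon_spec ⟨_, isHeatSolution_one g⟩
  simp only [heatContent, h.eq_one _ ht]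
  simp

end HeatEquation

end HeatContent

end

theorem proposition1
    {n₁ : ℕ} {M₁ : Type*} [TopologicalSpace M₁] [T2Space M₁] [CompactSpace M₁]
    [ChartedSpace (EuclideanSpace ℝ (Fin n₁)) M₁] [IsManifold (𝓡 n₁) ∞ M₁]
    [MeasurableSpace M₁] [BorelSpace M₁] (g₁ : HeatContent.Metric (𝓡 n₁) M₁)
    {n₂ : ℕ} {M₂ : Type*} [TopologicalSpace M₂] [T2Space M₂] [CompactSpace M₂]
    [ChartedSpace (EuclideanSpace ℝ (Fin n₂)) M₂] [IsManifold (𝓡 n₂) ∞ M₂]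
    [MeasurableSpace M₂] [BorelSpace M₂] (g₂ : HeatContent.Metric (𝓡 n₂) M₂)
    (hvol : HeatContent.riemannianVolume g₁ univ = HeatContent.riemannianVolume g₂ univ) :
    HeatContent.HasUniqueHeatSolution g₁ ∧ HeatContent.HasUniqueHeatSolution g₂ ∧
    HeatContent.riemannianVolume g₁ univ < ⊤ ∧ HeatContent.riemannianVolume g₂ univ < ⊤ ∧
    (∀ t ≥ 0, HeatContent.heatContent g₁ t = (HeatContent.riemannianVolume g₁).real univ) ∧
    (∀ t ≥ 0, HeatContent.heatContent g₂ t = (HeatContent.riemannianVolume g₂).real univ) ∧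
    HeatContent.Isoheat g₁ g₂ := by
  have hQ : ∀ t ≥ 0, HeatContent.heatContent g₁ t = HeatContent.heatContent g₂ t := fun t ht => by
    rw [HeatContent.heatContent_eq_volume g₁ ht, HeatContent.heatContent_eq_volume g₂ ht,
      measureReal_def, measureReal_def, hvol]
  exact ⟨HeatContent.hasUniqueHeatSolution g₁, HeatContent.hasUniqueHeatSolution g₂,
    measure_lt_top _ _, measure_lt_top _ _, fun _ ht => HeatContent.heatContent_eq_volume g₁ ht,
    fun _ ht => HeatContent.heatContent_eq_volume g₂ ht, fun t ht => hQ t ht.le⟩
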